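/- Let $1\le \ell\le d$ be integers and $[d]=\{1,\dots,d\}$. For $v:2^{[d]}\to\mathbb R$ and disjoint $S,T\subseteq[d]$ let $\Delta_S(v(T))=\sum_{L\subseteq S}(-1)^{|S|-|L|}v(T\cup L)$ be the discrete derivative. The Faithful Shapley Interaction index of maximum order $\ell$ is $\mathcal E^{\mathrm{F\text{-}Shap}}(v,\ell)=(\mathcal E^{\mathrm{F\text{-}Shap}}_S(v,\ell))_{S\subseteq[d],\,|S|\le\ell}$, the solution of the constrained weighted regression problem of minimizing $$\sum_{S\subseteq[d],\ 1\le|S|\le d-1}\mu(S)\Big(v(S)-\sum_{T\subseteq S,\,|T|\le\ell}\mathcal E_T\Big)^2$$ over all real families $(\mathcal E_T)_{|T|\le\ell}$ such that $\mathcal E_\emptyset=v(\emptyset)$ and $\sum_{|T|\le\ell}\mathcal E_T=v([d])$, where $\mu(S)\propto\frac{d-1}{\binom d{|S|}\,|S|\,(d-|S|)}$ with a positive constant of proportionality (equivalently, $\mu(\emptyset)=\mu([d])=\infty$). This solution exists, is unique, and does not depend on the constant of proportionality. Put $$p^\ell_t=\frac{(2\ell-1)!\,(\ell+t-1)!\,(d-t-1)!}{((\ell-1)!)^2\,(d+\ell-1)!},\qquad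 0\le t\le d-\ell .$$ Then for every $v:2^{[d]}\to\mathbb R$ and every $S\subseteq[d]$ with $|S|=\ell$, $$\mathcal E^{\mathrm{F\text{-}Shap}}_S(v,\ell)=\sum_{T\subseteq[d]\setminus S}p^\ell_{|T|}\,\Delta_S(v(T)).$$ Moreover $\sum_{t=0}^{d-\ell}\binom{d-\ell}{t}p^\ell_t=1$. Hence the top level of the index is cardinal-probabilistic: for each $S$ with $|S|=\ell$ the numbers $p^\ell_{|T|}$, which depend only on $\ell$, $d$ and $|T|$, form a probability distribution on the subsets $T\subseteq[d]\setminus S$, and $\mathcal E^{\mathrm{F\text{-}Shap}}_S(v,\ell)$ is the corresponding average of $\Delta_S(v(T))$ for every $v$. -/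

import Mathlib

open scoped Nat ENNReal

namespace FaithShap

/-- A set value function on the players `[d]`. -/
abbrev Game (d : ℕ) : Type := Finset (Fin d) → ℝ

/-- The coalitions of size at most `ℓ`. -/
abbrev LowCoalition (d ℓ : ℕ) : Type := {S : Finset (Fin d) // S.card ≤ ℓ}

/-- The values of an interaction index of maximum order `ℓ` at one game: one real number for each
coalition of size at most `ℓ`. -/
abbrev Interactions (d ℓ : ℕ) : Type := LowCoalition d ℓ → ℝ

/-- The discrete derivative `Δ_S (v(T))` (used for disjoint `S` and `T`). -/
def discreteDerivative {d : ℕ} (v : Game d) (S T : Finset (Fin d)) : ℝ :=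
  ∑ L ∈ S.powerset, (-1 : ℝ) ^ (S.card - L.card) * v (T ∪ L)

/-- The discrete derivative in no direction is the value function. -/
theorem discreteDerivative_empty {d : ℕ} (v : Game d) (T : Finset (Fin d)) :
    discreteDerivative v ∅ T = v T := by
  simp [discreteDerivative]

/-- The recursion for discrete derivatives, `Δ_{S ∪ i} v(T) = Δ_S v(T ∪ i) - Δ_S v(T)`. -/
theorem discreteDerivative_insert {d : ℕ} (v : Game d) (S T : Finset (Fin d)) (i : Fin d)
    (hi : i ∉ S) :
    discreteDerivative v (insert i S) T =
      discreteDerivative v S (insert i T) - discreteDerivative v S T := by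
  unfold discreteDerivative
  rw [Finset.sum_powerset_insert hi, add_comm, sub_eq_add_neg, ← Finset.sum_neg_distrib]
  congr 1
  · refine Finset.sum_congr rfl fun L hL => ?_
    have hLi : i ∉ L := fun h => hi (Finset.mem_powerset.1 hL h)
    rw [Finset.card_insert_of_notMem hi, Finset.card_insert_of_notMem hLi, Nat.add_sub_add_right,
      Finset.union_insert, Finset.insert_union]
  · refine Finset.sum_congr rfl fun L hL => ?_
    have hc := Finset.card_le_card (Finset.mem_powerset.1 hL)
    rw [Finset.card_insert_of_notMem hi, Nat.succ_sub hc, pow_succ]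
    ring

/-- The approximation `∑_{T ⊆ S, |T| ≤ ℓ} E_T` of `v(S)`. -/
def approx {d ℓ : ℕ} (E : Interactions d ℓ) (S : Finset (Fin d)) : ℝ :=
  ∑ T : LowCoalition d ℓ with T.1 ⊆ S, E T

/-- The weighted squared error, over the coalitions of finite weight. -/
noncomputable def regressionLoss {d ℓ : ℕ} (μ : Finset (Fin d) → ℝ≥0∞) (v : Game d)
    (E : Interactions d ℓ) : ℝ :=
  open Classical in
  ∑ S : Finset (Fin d) with μ S ≠ ⊤, (μ S).toReal * (v S - approx E S) ^ 2

/-- The interactions that fit `v` exactly on every coalition of infinite weight. -/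
def feasible {d : ℕ} (ℓ : ℕ) (μ : Finset (Fin d) → ℝ≥0∞) (v : Game d) :
    Set (Interactions d ℓ) :=
  {E | ∀ S, μ S = ⊤ → v S = approx E S}

/-- `E` solves the constrained weighted regression problem for `v` with coalition weights `μ`. -/
def IsRegressionSolution {d ℓ : ℕ} (μ : Finset (Fin d) → ℝ≥0∞) (v : Game d)
    (E : Interactions d ℓ) : Prop :=
  E ∈ feasible ℓ μ v ∧ IsMinOn (regressionLoss μ v) (feasible ℓ μ v) E

/-- Shapley weights: infinite at `∅` and `[d]`, and proportional to
`(d - 1) / (C(d, |S|) |S| (d - |S|))` at every other coalition `S`. -/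
def IsShapleyWeighting {d : ℕ} (μ : Finset (Fin d) → ℝ≥0∞) : Prop :=
  μ ∅ = ⊤ ∧ μ Finset.univ = ⊤ ∧
    ∃ c : ℝ, 0 < c ∧ ∀ S : Finset (Fin d), 1 ≤ S.card → S.card ≤ d - 1 →
      μ S = ENNReal.ofReal
        (c * (((d : ℝ) - 1) / ((d.choose S.card : ℝ) * (S.card : ℝ) * ((d : ℝ) - (S.card : ℝ)))))

/-- `E` is the value at `v` of the Faithful Shapley Interaction index of maximum order `ℓ`:
it solves the constrained regression problem with Shapley weights. -/
def IsFaithShap {d ℓ : ℕ} (v : Game d) (E : Interactions d ℓ) : Prop :=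
  ∃ μ : Finset (Fin d) → ℝ≥0∞, IsShapleyWeighting μ ∧ IsRegressionSolution μ v E

/-- The top level `(Φ_S)_{|S| = ℓ}` of the interaction index `Φ` is cardinal-probabilistic with
constants `p t`: for each `S` of size `ℓ` the weights `p |T|` form a probability distribution on
the subsets `T` of `[d] ∖ S`, and `Φ_S(v)` is the corresponding average of `Δ_S (v(T))`. -/
def IsTopCardinalProbabilistic {d ℓ : ℕ} (Φ : Game d → Interactions d ℓ) (p : ℕ → ℝ) : Prop :=
  ∀ (S : Finset (Fin d)) (hS : S.card = ℓ),
    ((∀ T ∈ (Finset.univ \ S).powerset, 0 ≤ p T.card) ∧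
      ∑ T ∈ (Finset.univ \ S).powerset, p T.card = 1) ∧
    ∀ v : Game d, Φ v ⟨S, hS.le⟩ =
      ∑ T ∈ (Finset.univ \ S).powerset, p T.card * discreteDerivative v S T

/-- The constants `p^ℓ_t` (used for `1 ≤ ℓ` and `t ≤ d - ℓ`). -/
noncomputable def topWeight (d ℓ t : ℕ) : ℝ :=
  ((2 * ℓ - 1)! * (ℓ + t - 1)! * (d - t - 1)! : ℝ) / (((ℓ - 1)! : ℝ) ^ 2 * (d + ℓ - 1)!)

end FaithShap

/-! The minimiser is characterised by normal equations (`IsNormal`): the residual r = v - `approx E`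
vanishes at ∅ and [d] and is orthogonal, for the Shapley weights, to every game of degree at most ℓ
vanishing at both. These have exactly one solution because the quadratic form is positive definite.

Fix |S| = ℓ. Expanding ∑_T p_|T| Δ_S r(T) over U = T ∪ L gives each r(U) the coefficient ±p_|U∖S|.
For U ≠ ∅, [d] this is a constant times the Shapley weight of U times `mixedFactorial d ℓ |U ∩ S|
|U|`. As a function of U, that factor has degree at most ℓ (`mixedFactorial_mem_lowDegree`, the
crux) and vanishes at ∅ and [d], so orthogonality makes the sum zero. Thus v and `approx E` have the
same average derivative; for `approx E` every Δ_S equals E_S, and the weights sum to 1. -/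

namespace FaithShap

open Finset

variable {d ℓ : ℕ}

/-! ### Approximations as combinations of unanimity games -/

/-- The unanimity game of the coalition `A`. -/
def unanimity (A : Finset (Fin d)) : Game d := fun U => if A ⊆ U then 1 else 0

/-- The approximation as a linear map from interactions to games. -/
def approxMap (d ℓ : ℕ) : Interactions d ℓ →ₗ[ℝ] Game d where
  toFun := approx
  map_add' E F := by
    ext S
    simp [approx, sum_add_distrib]
  map_smul' c E := by
    ext S
    simp [approx, mul_sum]

theorem approx_add (E F : Interactions d ℓ) (S : Finset (Fin d)) :
    approx (E + F) S = approx E S + approx F S :=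
  congrFun ((approxMap d ℓ).map_add E F) S

theorem approx_sub (E F : Interactions d ℓ) (S : Finset (Fin d)) :
    approx (E - F) S = approx E S - approx F S :=
  congrFun ((approxMap d ℓ).map_sub E F) S

theorem approx_smul (c : ℝ) (E : Interactions d ℓ) (S : Finset (Fin d)) :
    approx (c • E) S = c * approx E S :=
  congrFun ((approxMap d ℓ).map_smul c E) S

theorem approx_eq_sum_unanimity (E : Interactions d ℓ) :
    approx E = ∑ A : LowCoalition d ℓ, E A • unanimity A.1 := by
  ext S
  simp [approx, unanimity, sum_filter]

theorem approx_single (A : LowCoalition d ℓ) :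
    approx (Pi.single A 1) = unanimity A.1 := by
  rw [approx_eq_sum_unanimity, sum_eq_single A]
  · simp
  · intro B _ hB
    simp [Pi.single_eq_of_ne hB]
  · simp

/-- An interaction is determined by its approximation. -/
theorem approx_injective (E : Interactions d ℓ) (h : ∀ S, approx E S = 0) : E = 0 := by
  have key : ∀ n, ∀ A : LowCoalition d ℓ, A.1.card = n → E A = 0 := by
    intro n
    induction n using Nat.strong_induction_on with
    | _ n ih =>
      intro A hA
      have hS := h A.1
      unfold approx at hS
      rw [sum_eq_single_of_mem A (by simp)] at hS
      · exact hS
      · intro B hB hne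
        have hsub : B.1 ⊆ A.1 := by simpa using hB
        have hlt : B.1.card < n := by
          rw [← hA]
          exact card_lt_card (hsub.ssubset_of_ne fun e => hne (Subtype.ext e))
        exact ih _ hlt B rfl
  funext A
  exact key _ A rfl

/-! ### Games of low degree and mixed factorials -/

/-- The games of degree at most `m`. -/
def lowDegree (d m : ℕ) : Submodule ℝ (Game d) := LinearMap.range (approxMap d m)

theorem unanimity_mem_lowDegree {m : ℕ} {A : Finset (Fin d)} (hA : A.card ≤ m) :
    unanimity A ∈ lowDegree d m :=
  ⟨Pi.single ⟨A, hA⟩ 1, approx_single (⟨A, hA⟩ : LowCoalition d m)⟩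

theorem lowDegree_mono {m n : ℕ} (h : m ≤ n) : lowDegree d m ≤ lowDegree d n := by
  rintro _ ⟨E, rfl⟩
  change approx E ∈ _
  rw [approx_eq_sum_unanimity]
  exact Submodule.sum_mem _ fun A _ =>
    Submodule.smul_mem _ _ (unanimity_mem_lowDegree (A.2.trans h))

/-- Restricting a game to the coalitions containing `i` raises the degree by at most one. -/
theorem ite_mem_lowDegree {m : ℕ} {f : Game d} (hf : f ∈ lowDegree d m) (i : Fin d) :
    (fun U => if i ∈ U then f U else 0) ∈ lowDegree d (m + 1) := by
  obtain ⟨E, rfl⟩ := hf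
  have : (fun U => if i ∈ U then approxMap d m E U else 0) =
      ∑ A : LowCoalition d m, E A • unanimity (insert i A.1) := by
    ext U
    change (if i ∈ U then approx E U else 0) = _
    rw [approx_eq_sum_unanimity]
    by_cases hi : i ∈ U <;> simp [unanimity, insert_subset_iff, hi]
  rw [this]
  exact Submodule.sum_mem _ fun A _ => Submodule.smul_mem _ _
    (unanimity_mem_lowDegree ((card_insert_le _ _).trans (by have := A.2; omega)))

theorem card_mul_mem_lowDegree {m : ℕ} {f : Game d} (hf : f ∈ lowDegree d m) :
    (fun U => (U.card : ℝ) * f U) ∈ lowDegree d (m + 1) := by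
  have : (fun U => (U.card : ℝ) * f U) = ∑ i, fun U => if i ∈ U then f U else 0 := by
    ext U
    simp
  rw [this]
  exact Submodule.sum_mem _ fun i _ => ite_mem_lowDegree hf i

theorem prod_card_add_mem_lowDegree (m : ℕ) :
    (fun U : Finset (Fin d) => ∏ i ∈ range m, ((U.card : ℝ) + i)) ∈ lowDegree d m := by
  induction m with
  | zero =>
    convert unanimity_mem_lowDegree (d := d) (m := 0) (A := ∅) (by simp) using 1
    ext U
    simp [unanimity]
  | succ m ih =>
    have : (fun U : Finset (Fin d) => ∏ i ∈ range (m + 1), ((U.card : ℝ) + i)) =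
        (fun U => (U.card : ℝ) * ∏ i ∈ range m, ((U.card : ℝ) + i)) +
          (m : ℝ) • fun U : Finset (Fin d) => ∏ i ∈ range m, ((U.card : ℝ) + i) := by
      ext U
      simp [prod_range_succ]
      ring
    rw [this]
    exact Submodule.add_mem _ (card_mul_mem_lowDegree ih)
      (Submodule.smul_mem _ _ (lowDegree_mono (Nat.le_succ m) ih))

/-- The product `x (x + 1) ⋯ (x + m - k - 1) · (x - D) (x - D - 1) ⋯ (x - D - k + 1)`. -/
noncomputable def mixedFactorial (D : ℝ) (m k : ℕ) (x : ℝ) : ℝ :=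
  (∏ i ∈ range (m - k), (x + i)) * ∏ i ∈ range k, (x - D - i)

/-- The factors x + (m - k) and x - D - k, exchanged when k grows by one, differ by the constant D +
m. -/
theorem mixedFactorial_succ (D : ℝ) {m k : ℕ} (h : k ≤ m) (x : ℝ) :
    mixedFactorial D (m + 1) (k + 1) x =
      mixedFactorial D (m + 1) k x - (D + m) * mixedFactorial D m k x := by
  unfold mixedFactorial
  rw [Nat.add_sub_add_right, Nat.succ_sub h, prod_range_succ, prod_range_succ, Nat.cast_sub h]
  ring

/-- Adding i to S changes the values only at U ∋ i, by a constant times a mixed factorial of order m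
- 1; restricting that one to U ∋ i costs one degree, so the total stays at m. -/
theorem mixedFactorial_mem_lowDegree (D : ℝ) (S : Finset (Fin d)) :
    ∀ m : ℕ, S.card ≤ m →
      (fun U : Finset (Fin d) => mixedFactorial D m (U ∩ S).card U.card) ∈ lowDegree d m := by
  induction S using Finset.induction_on with
  | empty =>
    intro m _
    simpa [mixedFactorial] using prod_card_add_mem_lowDegree (d := d) m
  | insert i S hi ih =>
    intro m hm
    rw [card_insert_of_notMem hi] at hm
    obtain ⟨m, rfl⟩ : ∃ n, m = n + 1 := ⟨m - 1, by omega⟩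
    have : (fun U : Finset (Fin d) => mixedFactorial D (m + 1) (U ∩ insert i S).card U.card) =
        (fun U => mixedFactorial D (m + 1) (U ∩ S).card U.card) - (D + m) •
          fun U => if i ∈ U then mixedFactorial D m (U ∩ S).card U.card else 0 := by
      ext U
      by_cases hU : i ∈ U
      · have hc : (U ∩ S).card ≤ m := (card_le_card inter_subset_right).trans (by omega)
        rw [inter_insert_of_mem hU, card_insert_of_notMem (by simp [hi]),
          mixedFactorial_succ D hc]
        simp [hU]
      · rw [inter_insert_of_notMem hU]
        simp [hU]
    rw [this]
    exact Submodule.sub_mem _ (ih _ (by omega))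
      (Submodule.smul_mem _ _ (ite_mem_lowDegree (ih m (by omega)) i))

/-! ### The constants sum to one -/

/-- This is the Beta integral of x^a (1-x)^b (x + (1-x))^n, expanded by the binomial theorem. The
induction uses Pascal's rule instead. -/
theorem sum_choose_mul_factorial (n : ℕ) : ∀ a b : ℕ,
    (∑ ij ∈ antidiagonal n, (n.choose ij.1 : ℝ) * ((a + ij.1)! * (b + ij.2)!)) * (a + b + 1)! =
      a ! * b ! * (a + b + n + 1)! := by
  induction n with
  | zero => intro a b; simp
  | succ n ih =>
    intro a b
    rw [sum_antidiagonal_choose_succ_mul fun i j => ((a + i)! * (b + j)! : ℝ)]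
    have h1 := ih a (b + 1)
    have h2 := ih (a + 1) b
    have e1 : ∑ ij ∈ antidiagonal n, (n.choose ij.2 : ℝ) * ((a + (ij.1 + 1))! * (b + ij.2)!) =
        ∑ ij ∈ antidiagonal n, (n.choose ij.1 : ℝ) * ((a + 1 + ij.1)! * (b + ij.2)!) := by
      refine sum_congr rfl fun ij hij => ?_
      rw [Nat.choose_symm_of_eq_add (mem_antidiagonal.1 hij).symm, add_right_comm, add_assoc]
    have e2 : ∑ ij ∈ antidiagonal n, (n.choose ij.1 : ℝ) * ((a + ij.1)! * (b + (ij.2 + 1))!) =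
        ∑ ij ∈ antidiagonal n, (n.choose ij.1 : ℝ) * ((a + ij.1)! * (b + 1 + ij.2)!) := by
      refine sum_congr rfl fun ij _ => ?_
      rw [add_right_comm b, add_assoc b]
    rw [e1, e2]
    rw [show a + (b + 1) + 1 = a + b + 1 + 1 by ring, show a + (b + 1) + n + 1 = a + b + n + 2 by ring,
      Nat.factorial_succ b, Nat.factorial_succ (a + b + 1)] at h1
    rw [show a + 1 + b + 1 = a + b + 1 + 1 by ring, show a + 1 + b + n + 1 = a + b + n + 2 by ring,
      Nat.factorial_succ a, Nat.factorial_succ (a + b + 1)] at h2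
    rw [show a + b + (n + 1) + 1 = a + b + n + 2 by ring]
    push_cast at h1 h2
    -- The two inductive cases carry the factors b + 1 and a + 1, whose sum is a + b + 2.
    have h0 : ((a : ℝ) + b + 2) ≠ 0 := by positivity
    refine mul_left_cancel₀ h0 ?_
    linear_combination h1 + h2

theorem sum_choose_mul_topWeight (hℓ : 1 ≤ ℓ) (hd : ℓ ≤ d) :
    ∑ t ∈ range (d - ℓ + 1), ((d - ℓ).choose t : ℝ) * topWeight d ℓ t = 1 := by
  obtain ⟨a, rfl⟩ : ∃ a, ℓ = a + 1 := ⟨ℓ - 1, by omega⟩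
  obtain ⟨n, rfl⟩ : ∃ n, d = a + 1 + n := ⟨d - (a + 1), by omega⟩
  have h := sum_choose_mul_factorial n a a
  rw [Nat.sum_antidiagonal_eq_sum_range_succ
    (fun i j => (n.choose i : ℝ) * ((a + i)! * (a + j)!))] at h
  rw [Nat.add_sub_cancel_left]
  have e : ∑ t ∈ range (n + 1), (n.choose t : ℝ) * topWeight (a + 1 + n) (a + 1) t =
      (∑ t ∈ range n.succ, (n.choose t : ℝ) * ((a + t)! * (a + (n - t))!)) * (a + a + 1)! /
        (a ! * a ! * (a + a + n + 1)!) := by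
    rw [sum_mul, sum_div]
    refine sum_congr rfl fun t ht => ?_
    have ht' : t ≤ n := by simpa [Nat.lt_succ_iff] using ht
    unfold topWeight
    rw [show 2 * (a + 1) - 1 = a + a + 1 by omega, show a + 1 + t - 1 = a + t by omega,
      show a + 1 + n - t - 1 = a + (n - t) by omega, show a + 1 - 1 = a by omega,
      show a + 1 + n + (a + 1) - 1 = a + a + n + 1 by omega]
    ring
  rw [e, h]
  exact div_self (by positivity)

theorem topWeight_nonneg (d ℓ t : ℕ) : 0 ≤ topWeight d ℓ t := by
  unfold topWeight
  positivity

theorem sum_powerset_topWeight (hℓ : 1 ≤ ℓ) (hd : ℓ ≤ d) {S : Finset (Fin d)}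
    (hS : S.card = ℓ) : ∑ T ∈ (univ \ S).powerset, topWeight d ℓ T.card = 1 := by
  have hc : (univ \ S).card = d - ℓ := by
    rw [card_sdiff_of_subset (subset_univ S), card_univ, Fintype.card_fin, hS]
  rw [sum_powerset_apply_card (topWeight d ℓ), hc]
  simpa using sum_choose_mul_topWeight hℓ hd

/-! ### Discrete derivatives of approximations -/

theorem discreteDerivative_sum_smul {ι : Type*} (s : Finset ι) (c : ι → ℝ) (f : ι → Game d)
    (S T : Finset (Fin d)) :
    discreteDerivative (∑ a ∈ s, c a • f a) S T = ∑ a ∈ s, c a * discreteDerivative (f a) S T := by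
  unfold discreteDerivative
  simp_rw [Finset.sum_apply, Pi.smul_apply, smul_eq_mul, mul_sum]
  rw [sum_comm]
  exact sum_congr rfl fun a _ => sum_congr rfl fun L _ => by ring

theorem discreteDerivative_sub (f g : Game d) (S T : Finset (Fin d)) :
    discreteDerivative (f - g) S T = discreteDerivative f S T - discreteDerivative g S T := by
  simp [discreteDerivative, mul_sub]

theorem discreteDerivative_unanimity_of_not_subset {A S : Finset (Fin d)} (h : ¬S ⊆ A)
    (T : Finset (Fin d)) : discreteDerivative (unanimity A) S T = 0 := by
  obtain ⟨i, hiS, hiA⟩ := not_subset.1 h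
  rw [← insert_erase hiS, discreteDerivative_insert _ _ _ _ (notMem_erase i S), sub_eq_zero]
  unfold discreteDerivative
  refine sum_congr rfl fun L _ => ?_
  simp only [unanimity, insert_union, subset_insert_iff_of_notMem hiA]

theorem discreteDerivative_unanimity_self {S T : Finset (Fin d)} (h : T ⊆ univ \ S) :
    discreteDerivative (unanimity S) S T = 1 := by
  have hd : Disjoint S T := (disjoint_sdiff (s := S) (t := univ)).mono_right h
  unfold discreteDerivative
  rw [sum_eq_single_of_mem S (mem_powerset_self S)]
  · simp [unanimity, subset_union_right]
  · intro L hL hne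
    have : ¬S ⊆ T ∪ L := fun hs =>
      hne ((mem_powerset.1 hL).antisymm (hd.left_le_of_le_sup_left hs))
    simp [unanimity, this]

/-- Δ_S kills the unanimity game of A unless S ⊆ A, and |A| ≤ ℓ = |S| then forces A = S. -/
theorem discreteDerivative_approx (E : Interactions d ℓ) {S T : Finset (Fin d)}
    (hS : S.card = ℓ) (h : T ⊆ univ \ S) :
    discreteDerivative (approx E) S T = E ⟨S, hS.le⟩ := by
  rw [approx_eq_sum_unanimity, discreteDerivative_sum_smul,
    sum_eq_single_of_mem ⟨S, hS.le⟩ (mem_univ _)]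
  · rw [discreteDerivative_unanimity_self h, mul_one]
  · intro A _ hne
    rw [discreteDerivative_unanimity_of_not_subset, mul_zero]
    intro hs
    exact hne (Subtype.ext (eq_of_subset_of_card_le hs (A.2.trans hS.ge)).symm)


/-! ### Shapley weights and the loss -/

/-- The Shapley weights, normalised as `(|S| - 1)! (d - |S| - 1)!`. -/
noncomputable def shapleyWeight (S : Finset (Fin d)) : ℝ := (S.card - 1)! * (d - S.card - 1)!

theorem shapleyWeight_pos (S : Finset (Fin d)) : 0 < shapleyWeight S := by
  unfold shapleyWeight
  positivity

theorem card_bounds {S : Finset (Fin d)} (h0 : S ≠ ∅) (h1 : S ≠ univ) :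
    1 ≤ S.card ∧ S.card + 1 ≤ d := by
  refine ⟨card_pos.2 (nonempty_iff_ne_empty.2 h0), ?_⟩
  have h : S.card ≠ (univ : Finset (Fin d)).card := fun e => h1 (card_eq_iff_eq_univ S |>.1 e)
  have h' := card_le_univ S
  rw [card_univ, Fintype.card_fin] at h
  rw [Fintype.card_fin] at h'
  omega

theorem shapleyWeight_eq {S : Finset (Fin d)} (h0 : S ≠ ∅) (h1 : S ≠ univ) :
    ((d : ℝ) - 1) / ((d.choose S.card : ℝ) * (S.card : ℝ) * ((d : ℝ) - (S.card : ℝ))) =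
      ((d : ℝ) - 1) / d ! * shapleyWeight S := by
  obtain ⟨hs, hd⟩ := card_bounds h0 h1
  unfold shapleyWeight
  obtain ⟨a, ha⟩ : ∃ a, S.card = a + 1 := ⟨S.card - 1, by omega⟩
  obtain ⟨b, hb⟩ : ∃ b, d = (a + 1) + (b + 1) := ⟨d - S.card - 1, by omega⟩
  have hc := Nat.choose_mul_factorial_mul_factorial (show a + 1 ≤ d by omega)
  rw [show d - (a + 1) = b + 1 by omega, Nat.factorial_succ a, Nat.factorial_succ b] at hc
  have hdR : (d : ℝ) = (a + 1) + (b + 1) := by exact_mod_cast hb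
  have hsub : (d : ℝ) - (S.card : ℝ) = b + 1 := by rw [hdR, ha]; push_cast; ring
  rw [hsub, ha, show d - (a + 1) - 1 = b by omega, Nat.add_sub_cancel, ← hc]
  have hch : (0 : ℝ) < d.choose (a + 1) := by exact_mod_cast Nat.choose_pos (by omega)
  push_cast
  field_simp

theorem IsShapleyWeighting.exists_const {μ : Finset (Fin d) → ℝ≥0∞} (h : IsShapleyWeighting μ) :
    ∃ c : ℝ, 0 < c ∧ ∀ S, S ≠ ∅ → S ≠ univ → μ S = ENNReal.ofReal (c * shapleyWeight S) := by
  obtain ⟨-, -, c, hc, hμ⟩ := h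
  -- The factor d - 1 is positive only for d ≥ 2; for smaller d every coalition is ∅ or [d], and any
  -- constant serves.
  by_cases hd : 2 ≤ d
  · have hd' : (0 : ℝ) < (d : ℝ) - 1 := by
      have : (2 : ℝ) ≤ d := by exact_mod_cast hd
      linarith
    refine ⟨c * (((d : ℝ) - 1) / d !), by positivity, fun S h0 h1 => ?_⟩
    have hb := card_bounds h0 h1
    rw [hμ S hb.1 (by omega), shapleyWeight_eq h0 h1, mul_assoc]
  · refine ⟨1, one_pos, fun S h0 h1 => ?_⟩
    have hb := card_bounds h0 h1
    omega

theorem IsShapleyWeighting.eq_top_iff {μ : Finset (Fin d) → ℝ≥0∞} (h : IsShapleyWeighting μ)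
    (S : Finset (Fin d)) : μ S = ⊤ ↔ S = ∅ ∨ S = univ := by
  obtain ⟨c, -, hc⟩ := h.exists_const
  constructor
  · intro ht
    by_contra hn
    rw [not_or] at hn
    rw [hc S hn.1 hn.2] at ht
    exact ENNReal.ofReal_ne_top ht
  · rintro (rfl | rfl)
    exacts [h.1, h.2.1]

theorem IsShapleyWeighting.mem_feasible_iff {μ : Finset (Fin d) → ℝ≥0∞} (h : IsShapleyWeighting μ)
    (v : Game d) (E : Interactions d ℓ) :
    E ∈ feasible ℓ μ v ↔ v ∅ = approx E ∅ ∧ v univ = approx E univ := by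
  simp [feasible, h.eq_top_iff]

/-- Feasible residuals vanish at ∅ and [d], so these coalitions can join the sum with the finite
positive value that `shapleyWeight` has there by truncated subtraction. -/
theorem IsShapleyWeighting.exists_regressionLoss_eq {μ : Finset (Fin d) → ℝ≥0∞}
    (h : IsShapleyWeighting μ) : ∃ c : ℝ, 0 < c ∧ ∀ (v : Game d) (E : Interactions d ℓ),
      E ∈ feasible ℓ μ v →
        regressionLoss μ v E = c * ∑ S, shapleyWeight S * (v S - approx E S) ^ 2 := by
  obtain ⟨c, hc, hμ⟩ := h.exists_const
  refine ⟨c, hc, fun v E hE => ?_⟩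
  unfold regressionLoss
  rw [sum_filter, mul_sum]
  refine sum_congr rfl fun S _ => ?_
  split_ifs with ht
  · rw [Ne, h.eq_top_iff, not_or] at ht
    rw [hμ S ht.1 ht.2, ENNReal.toReal_ofReal (mul_pos hc (shapleyWeight_pos S)).le, mul_assoc]
  · rw [hE S (not_not.1 ht)]
    simp

theorem exists_isShapleyWeighting (hd : 1 ≤ d) :
    ∃ μ : Finset (Fin d) → ℝ≥0∞, IsShapleyWeighting μ := by
  classical
  refine ⟨fun S => if S = ∅ ∨ S = univ then ⊤ else ENNReal.ofReal
    (1 * (((d : ℝ) - 1) / ((d.choose S.card : ℝ) * (S.card : ℝ) * ((d : ℝ) - (S.card : ℝ))))),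
    by simp, by simp, 1, one_pos, fun S h1 h2 => ?_⟩
  refine if_neg ?_
  rintro (rfl | rfl)
  · simp at h1
  · rw [card_univ, Fintype.card_fin] at h2
    omega

/-! ### Normal equations, uniqueness and existence -/

/-- The normal equations of the constrained regression problem. -/
structure IsNormal (v : Game d) (E : Interactions d ℓ) : Prop where
  empty : v ∅ = approx E ∅
  univ : v univ = approx E univ
  orthogonal : ∀ F : Interactions d ℓ, approx F ∅ = 0 → approx F Finset.univ = 0 →
    ∑ S, shapleyWeight S * (v S - approx E S) * approx F S = 0

theorem sum_sq_residual_add (v : Game d) (E F : Interactions d ℓ) :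
    ∑ S, shapleyWeight S * (v S - approx (E + F) S) ^ 2 =
      ∑ S, shapleyWeight S * (v S - approx E S) ^ 2 -
        2 * ∑ S, shapleyWeight S * (v S - approx E S) * approx F S +
        ∑ S, shapleyWeight S * approx F S ^ 2 := by
  rw [mul_sum, ← sum_sub_distrib, ← sum_add_distrib]
  refine sum_congr rfl fun S _ => ?_
  rw [approx_add]
  ring

theorem sum_shapleyWeight_mul_sq_nonneg (F : Interactions d ℓ) :
    0 ≤ ∑ S, shapleyWeight S * approx F S ^ 2 :=
  sum_nonneg fun S _ => mul_nonneg (shapleyWeight_pos S).le (sq_nonneg _)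

theorem eq_zero_of_sum_sq_eq_zero {F : Interactions d ℓ}
    (h : ∑ S, shapleyWeight S * approx F S ^ 2 = 0) : F = 0 := by
  refine approx_injective F fun S => ?_
  have h' := (sum_eq_zero_iff_of_nonneg fun S _ =>
    mul_nonneg (shapleyWeight_pos S).le (sq_nonneg (approx F S))).1 h S (mem_univ S)
  simpa [(shapleyWeight_pos S).ne'] using h'

theorem IsFaithShap.isNormal {v : Game d} {E : Interactions d ℓ} (h : IsFaithShap v E) :
    IsNormal v E := by
  obtain ⟨μ, hμ, hE, hmin⟩ := h
  have hE' := (hμ.mem_feasible_iff v E).1 hE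
  refine ⟨hE'.1, hE'.2, fun F hF0 hF1 => ?_⟩
  obtain ⟨c, hc, hloss⟩ := hμ.exists_regressionLoss_eq (ℓ := ℓ)
  set a := ∑ S, shapleyWeight S * approx F S ^ 2 with ha
  set b := ∑ S, shapleyWeight S * (v S - approx E S) * approx F S with hb
  have ha0 : 0 ≤ a := sum_shapleyWeight_mul_sq_nonneg F
  have key : ∀ t : ℝ, 0 ≤ t ^ 2 * a - 2 * t * b := by
    intro t
    have hf : E + t • F ∈ feasible ℓ μ v := by
      rw [hμ.mem_feasible_iff, approx_add, approx_add, approx_smul, approx_smul, hF0, hF1]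
      simpa using hE'
    have hle : regressionLoss μ v E ≤ regressionLoss μ v (E + t • F) := hmin hf
    rw [hloss v E hE, hloss v _ hf] at hle
    have hle' := le_of_mul_le_mul_left hle hc
    rw [sum_sq_residual_add] at hle'
    have e1 : ∑ S, shapleyWeight S * (v S - approx E S) * approx (t • F) S = t * b := by
      rw [hb, mul_sum]
      exact sum_congr rfl fun S _ => by rw [approx_smul]; ring
    have e2 : ∑ S, shapleyWeight S * approx (t • F) S ^ 2 = t ^ 2 * a := by
      rw [ha, mul_sum]
      exact sum_congr rfl fun S _ => by rw [approx_smul]; ring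
    rw [e1, e2] at hle'
    linarith
  -- The minimiser would be b / a; using a + 1 avoids a = 0 and still makes the quadratic negative
  -- unless b = 0.
  have h1 := key (b / (a + 1))
  have h2 : (b / (a + 1)) ^ 2 * a - 2 * (b / (a + 1)) * b =
      -(b ^ 2 * (a + 2) / (a + 1) ^ 2) := by
    field_simp
    ring
  rw [h2, neg_nonneg] at h1
  by_contra hne
  have : 0 < b ^ 2 * (a + 2) / (a + 1) ^ 2 := by positivity
  linarith

theorem IsNormal.isFaithShap (hd : 1 ≤ d) {v : Game d} {E : Interactions d ℓ}
    (h : IsNormal v E) : IsFaithShap v E := by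
  obtain ⟨μ, hμ⟩ := exists_isShapleyWeighting hd
  have hE : E ∈ feasible ℓ μ v := (hμ.mem_feasible_iff v E).2 ⟨h.empty, h.univ⟩
  refine ⟨μ, hμ, hE, fun E' hE' => ?_⟩
  obtain ⟨c, hc, hloss⟩ := hμ.exists_regressionLoss_eq (ℓ := ℓ)
  have hF := (hμ.mem_feasible_iff v E').1 hE'
  change regressionLoss μ v E ≤ regressionLoss μ v E'
  rw [hloss v E hE, hloss v E' hE', ← add_sub_cancel E E', sum_sq_residual_add,
    h.orthogonal (E' - E) (by rw [approx_sub, ← hF.1, ← h.empty, sub_self])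
      (by rw [approx_sub, ← hF.2, ← h.univ, sub_self])]
  refine mul_le_mul_of_nonneg_left ?_ hc.le
  have := sum_shapleyWeight_mul_sq_nonneg (E' - E)
  linarith

theorem IsNormal.unique {v : Game d} {E E' : Interactions d ℓ} (h : IsNormal v E)
    (h' : IsNormal v E') : E = E' := by
  have h0 : approx (E - E') ∅ = 0 := by rw [approx_sub, ← h.empty, ← h'.empty, sub_self]
  have h1 : approx (E - E') Finset.univ = 0 := by rw [approx_sub, ← h.univ, ← h'.univ, sub_self]
  refine sub_eq_zero.1 (eq_zero_of_sum_sq_eq_zero ?_)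
  have e := congrArg₂ (· - ·) (h'.orthogonal _ h0 h1) (h.orthogonal _ h0 h1)
  simp only [← sum_sub_distrib, sub_self] at e
  rw [← e]
  refine sum_congr rfl fun S _ => ?_
  rw [approx_sub]
  ring

/-- The directions in which an interaction can move without violating the constraints. -/
def feasibleDirections (d ℓ : ℕ) : Submodule ℝ (Interactions d ℓ) where
  carrier := {F | approx F ∅ = 0 ∧ approx F univ = 0}
  add_mem' {E F} hE hF := by simp [approx_add, hE.1, hE.2, hF.1, hF.2]
  zero_mem' := by simp [approx]
  smul_mem' c F hF := by simp [approx_smul, hF.1, hF.2]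

/-- The weighted pairing of a game with the approximations by feasible directions. -/
noncomputable def weightedPairing (d ℓ : ℕ) :
    Game d →ₗ[ℝ] Module.Dual ℝ (feasibleDirections d ℓ) :=
  LinearMap.mk₂ ℝ (fun (u : Game d) (F : feasibleDirections d ℓ) =>
      ∑ S, shapleyWeight S * u S * approx F.1 S)
    (fun u u' F => by simp [mul_add, add_mul, sum_add_distrib])
    (fun c u F => by
      simp only [Pi.smul_apply, smul_eq_mul, mul_sum]
      exact sum_congr rfl fun S _ => by ring)
    (fun u F F' => by simp [approx_add, mul_add, sum_add_distrib])
    (fun c u F => by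
      simp only [Submodule.coe_smul, approx_smul, smul_eq_mul, mul_sum]
      exact sum_congr rfl fun S _ => by ring)

theorem weightedPairing_apply (u : Game d) (F : feasibleDirections d ℓ) :
    weightedPairing d ℓ u F = ∑ S, shapleyWeight S * u S * approx F.1 S := rfl

/-- Definiteness makes the pairing injective into the dual, hence surjective by equality of
dimensions. -/
theorem exists_feasibleDirection (u : Game d) : ∃ F : feasibleDirections d ℓ,
    weightedPairing d ℓ (approx F.1) = weightedPairing d ℓ u := by
  let B : feasibleDirections d ℓ →ₗ[ℝ] Module.Dual ℝ (feasibleDirections d ℓ) :=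
    weightedPairing d ℓ ∘ₗ approxMap d ℓ ∘ₗ (feasibleDirections d ℓ).subtype
  have hB : Function.Injective B := by
    rw [injective_iff_map_eq_zero]
    intro F hF
    refine Subtype.ext (eq_zero_of_sum_sq_eq_zero ?_)
    have h : weightedPairing d ℓ (approx F.1) F = 0 := LinearMap.congr_fun hF F
    rw [weightedPairing_apply] at h
    rw [← h]
    exact sum_congr rfl fun S _ => by ring
  exact (LinearMap.injective_iff_surjective_of_finrank_eq_finrank
    (Subspace.dual_finrank_eq).symm).1 hB _

theorem exists_isNormal (hℓ : 1 ≤ ℓ) (hd : ℓ ≤ d) (v : Game d) :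
    ∃ E : Interactions d ℓ, IsNormal v E := by
  let i : Fin d := ⟨0, by omega⟩
  -- Any feasible point will do; ℓ ≥ 1 allows one supported on ∅ and a singleton.
  let E₀ : Interactions d ℓ := v ∅ • Pi.single ⟨∅, by simp⟩ 1 +
    (v univ - v ∅) • Pi.single ⟨{i}, by simpa using hℓ⟩ 1
  have h0 : approx E₀ ∅ = v ∅ := by
    simp [E₀, approx_add, approx_smul, approx_single, unanimity]
  have h1 : approx E₀ univ = v univ := by
    simp [E₀, approx_add, approx_smul, approx_single, unanimity]
  obtain ⟨F, hF⟩ := exists_feasibleDirection (ℓ := ℓ) (v - approx E₀)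
  refine ⟨E₀ + F.1, ?_, ?_, fun G hG0 hG1 => ?_⟩
  · rw [approx_add, h0, F.2.1, add_zero]
  · rw [approx_add, h1, F.2.2, add_zero]
  · have h := LinearMap.congr_fun hF (⟨G, hG0, hG1⟩ : feasibleDirections d ℓ)
    rw [weightedPairing_apply, weightedPairing_apply, eq_comm, ← sub_eq_zero,
      ← sum_sub_distrib] at h
    rw [← h]
    refine sum_congr rfl fun S _ => ?_
    rw [approx_add, Pi.sub_apply]
    ring

/-! ### The top level formula -/

theorem sum_powerset_sdiff_powerset {α : Type*} [Fintype α] [DecidableEq α] (S : Finset α)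
    (g : Finset α → Finset α → ℝ) :
    ∑ T ∈ (univ \ S).powerset, ∑ L ∈ S.powerset, g T L = ∑ U, g (U \ S) (U ∩ S) := by
  have key : ∀ p ∈ (univ \ S).powerset ×ˢ S.powerset,
      (p.1 ∪ p.2) \ S = p.1 ∧ (p.1 ∪ p.2) ∩ S = p.2 := by
    intro p hp
    simp only [mem_product, mem_powerset] at hp
    have h1 : Disjoint p.1 S := sdiff_disjoint.mono_left hp.1
    rw [union_sdiff_distrib, sdiff_eq_self_of_disjoint h1, sdiff_eq_empty_iff_subset.2 hp.2,
      union_empty, union_inter_distrib_right, disjoint_iff_inter_eq_empty.1 h1, empty_union,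
      inter_eq_left.2 hp.2]
    exact ⟨rfl, rfl⟩
  rw [← sum_product']
  refine sum_nbij' (fun p => p.1 ∪ p.2) (fun U => (U \ S, U ∩ S)) (by simp) (fun U _ => ?_)
    (fun p hp => Prod.ext (key p hp).1 (key p hp).2) (fun U _ => sdiff_union_inter U S)
    (fun p hp => by rw [(key p hp).1, (key p hp).2])
  simp only [mem_product, mem_powerset]
  exact ⟨sdiff_subset_sdiff (subset_univ U) subset_rfl, inter_subset_right⟩

theorem factorial_mul_prod_add (a n : ℕ) :
    (a ! : ℝ) * ∏ i ∈ range n, ((a : ℝ) + 1 + i) = (a + n)! := by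
  induction n with
  | zero => simp
  | succ n ih =>
    rw [prod_range_succ, ← mul_assoc, ih, ← add_assoc, Nat.factorial_succ]
    push_cast
    ring

theorem prod_neg_sub (x : ℝ) (n : ℕ) :
    ∏ i ∈ range n, (-x - i) = (-1) ^ n * ∏ i ∈ range n, (x + i) := by
  rw [← card_range n, ← prod_const, card_range, ← prod_mul_distrib]
  exact prod_congr rfl fun i _ => by ring

/-- The coefficient of `v(U)` in the top level formula is, up to a constant, the Shapley weight of
`U` times a game of degree at most `ℓ`. -/
theorem neg_one_pow_mul_topWeight {S U : Finset (Fin d)} (hS : S.card = ℓ)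
    (h0 : U ≠ ∅) (h1 : U ≠ univ) :
    (-1 : ℝ) ^ (S.card - (U ∩ S).card) * topWeight d ℓ (U \ S).card =
      (-1) ^ ℓ * (2 * ℓ - 1)! / (((ℓ - 1)! : ℝ) ^ 2 * (d + ℓ - 1)!) *
        (shapleyWeight U * mixedFactorial d ℓ (U ∩ S).card U.card) := by
  obtain ⟨hu, hd⟩ := card_bounds h0 h1
  have hk : (U ∩ S).card ≤ ℓ := hS ▸ card_le_card inter_subset_right
  have ht := card_sdiff_add_card_inter U S
  obtain ⟨a, ha⟩ : ∃ a, U.card = a + 1 := ⟨U.card - 1, by omega⟩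
  obtain ⟨b, hb⟩ : ∃ b, d = (a + 1) + (b + 1) := ⟨d - U.card - 1, by omega⟩
  set k := (U ∩ S).card
  -- With t = |U ∖ S|, (ℓ+t-1)! = (a+ℓ-k)! and (d-t-1)! = (b+k)!. Dividing by the Shapley weight a!
  -- b! leaves rising factorials of |U| and d - |U|; the sign (-1)^k turns the latter into factors
  -- |U| - d - i.
  have p1 := factorial_mul_prod_add a (ℓ - k)
  have p2 := factorial_mul_prod_add b k
  have e : ((a + 1 : ℕ) : ℝ) - d = -((b : ℝ) + 1) := by
    have hdR : (d : ℝ) = (a + 1) + (b + 1) := by exact_mod_cast hb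
    rw [hdR]
    push_cast
    ring
  unfold topWeight shapleyWeight mixedFactorial
  rw [ha, e, prod_neg_sub, hS, show ℓ + (U \ S).card - 1 = a + (ℓ - k) by omega,
    show d - (U \ S).card - 1 = b + k by omega, show d - (a + 1) - 1 = b by omega,
    Nat.add_sub_cancel, ← p1, ← p2]
  have hs : (-1 : ℝ) ^ (ℓ - k) = (-1) ^ ℓ * (-1) ^ k := by
    obtain ⟨m, hm⟩ := Nat.exists_eq_add_of_le hk
    rw [hm, Nat.add_sub_cancel_left, pow_add, mul_right_comm, ← mul_pow]
    simp
  rw [hs]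
  push_cast
  ring

theorem mixedFactorial_empty (S : Finset (Fin d)) (hℓ : 1 ≤ ℓ) :
    mixedFactorial d ℓ (∅ ∩ S).card (∅ : Finset (Fin d)).card = 0 := by
  unfold mixedFactorial
  rw [prod_eq_zero (i := 0) (by simp; omega) (by simp), zero_mul]

theorem mixedFactorial_univ {S : Finset (Fin d)} (hℓ : 1 ≤ ℓ) (hS : S.card = ℓ) :
    mixedFactorial d ℓ (univ ∩ S).card (univ : Finset (Fin d)).card = 0 := by
  unfold mixedFactorial
  rw [mul_comm, prod_eq_zero (i := 0) (by simp [hS]; omega) (by simp), zero_mul]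

theorem IsNormal.sum_topWeight_residual {v : Game d} {E : Interactions d ℓ} (h : IsNormal v E)
    (hℓ : 1 ≤ ℓ) {S : Finset (Fin d)} (hS : S.card = ℓ) :
    ∑ T ∈ (Finset.univ \ S).powerset,
      topWeight d ℓ T.card * discreteDerivative (v - approx E) S T = 0 := by
  obtain ⟨F, hF⟩ := mixedFactorial_mem_lowDegree (d := d) d S ℓ hS.le
  have hF' : ∀ U, approx F U = mixedFactorial d ℓ (U ∩ S).card U.card := fun U => congrFun hF U
  have ho := h.orthogonal F (by rw [hF', mixedFactorial_empty S hℓ])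
    (by rw [hF', mixedFactorial_univ hℓ hS])
  unfold discreteDerivative
  simp_rw [mul_sum]
  rw [sum_powerset_sdiff_powerset S fun T L => topWeight d ℓ T.card *
    ((-1 : ℝ) ^ (S.card - L.card) * (v - approx E) (T ∪ L))]
  rw [← mul_zero ((-1) ^ ℓ * (2 * ℓ - 1)! / (((ℓ - 1)! : ℝ) ^ 2 * (d + ℓ - 1)!)), ← ho, mul_sum]
  refine sum_congr rfl fun U _ => ?_
  rw [sdiff_union_inter, Pi.sub_apply, hF']
  -- The coefficient identity is unavailable at ∅ and [d], but the residual vanishes there.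
  by_cases h0 : U = ∅
  · rw [h0, h.empty]; simp
  by_cases h1 : U = Finset.univ
  · rw [h1, h.univ]; simp
  have := neg_one_pow_mul_topWeight hS h0 h1
  linear_combination (v U - approx E U) * this

theorem IsNormal.top_eq {v : Game d} {E : Interactions d ℓ} (h : IsNormal v E)
    (hℓ : 1 ≤ ℓ) (hd : ℓ ≤ d) {S : Finset (Fin d)} (hS : S.card = ℓ) :
    E ⟨S, hS.le⟩ = ∑ T ∈ (Finset.univ \ S).powerset,
      topWeight d ℓ T.card * discreteDerivative v S T := by
  have hr := h.sum_topWeight_residual hℓ hS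
  simp_rw [discreteDerivative_sub, mul_sub, sum_sub_distrib] at hr
  rw [sub_eq_zero.1 hr, sum_congr rfl fun T hT =>
    congrArg (topWeight d ℓ T.card * ·) (discreteDerivative_approx E hS (mem_powerset.1 hT)),
    ← sum_mul, sum_powerset_topWeight hℓ hd hS, one_mul]

end FaithShap

theorem mainTheorem9 (d ℓ : ℕ) (hℓ : 1 ≤ ℓ) (hd : ℓ ≤ d) :
    (∀ v : FaithShap.Game d, ∃! E : FaithShap.Interactions d ℓ, FaithShap.IsFaithShap v E) ∧
    (∀ (v : FaithShap.Game d) (E : FaithShap.Interactions d ℓ), FaithShap.IsFaithShap v E →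
      ∀ (S : Finset (Fin d)) (hS : S.card = ℓ),
        E ⟨S, hS.le⟩ = ∑ T ∈ (Finset.univ \ S).powerset,
          FaithShap.topWeight d ℓ T.card * FaithShap.discreteDerivative v S T) ∧
    ∑ t ∈ Finset.range (d - ℓ + 1),
      ((d - ℓ).choose t : ℝ) * FaithShap.topWeight d ℓ t = 1 ∧
    (∀ Φ : FaithShap.Game d → FaithShap.Interactions d ℓ,
      (∀ v : FaithShap.Game d, FaithShap.IsFaithShap v (Φ v)) →
        FaithShap.IsTopCardinalProbabilistic Φ (FaithShap.topWeight d ℓ)) := by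
  refine ⟨fun v => ?_, fun v E hE S hS => hE.isNormal.top_eq hℓ hd hS,
    FaithShap.sum_choose_mul_topWeight hℓ hd, fun Φ hΦ S hS =>
      ⟨⟨fun T _ => FaithShap.topWeight_nonneg d ℓ T.card,
        FaithShap.sum_powerset_topWeight hℓ hd hS⟩,
        fun v => (hΦ v).isNormal.top_eq hℓ hd hS⟩⟩
  obtain ⟨E, hE⟩ := FaithShap.exists_isNormal hℓ hd v
  exact ⟨E, hE.isFaithShap (hℓ.trans hd), fun E' hE' => hE'.isNormal.unique hE⟩
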